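/- Let $G$ be a totally disconnected locally compact (Hausdorff) topological group, let $\varphi: G\to G$ be a topological automorphism (a group automorphism that is a homeomorphism), and let $H$ be a closed normal subgroup of $G$ that is $\varphi$-stable, i.e. $\varphi(H)=H$. Then $$h_{top}(\varphi)=h_{top}(\varphi\restriction_H)+h_{top}(\bar\varphi)\quad\text{in }[0,\infty],$$ where $\varphi\restriction_H:H\to H$ is the restriction of $\varphi$ and $\bar\varphi:G/H\to G/H$, $xH\mapsto\varphi(x)H$, is the topological automorphism induced by $\varphi$. Here $h_{top}$ denotes the topological entropy in the sense of Bowen and Hood, computed in each of $G$, $H$, $G/H$ with respect to the left uniformity of the group (the one with fundamental entourages $\{(x,y): y^{-1}x\in V\}$, $V$ a neighbourhood of $1$): for a uniformly continuous self-map $f:X\to X$ of a uniform space $X$, $$h_{top}(f)=\sup_{K}\ \sup_{U}\ \limsup_{n\to\infty}\frac{\log r_n(U,K,f)}{n},$$ where $K$ ranges over the compact subsets of $X$, $U$ over the entourages of $X$, and $r_n(U,K,f)$ is the least cardinality of a finite set $S\subseteq X$ such that for every $x\in K$ there is $y\in S$ with $(f^k(x),f^k(y))\in U$ for all $0\le k<n$.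 -/

import Mathlib

/-- The topological entropy (in the sense of Bowen and Hood) of a self-map `f` of a uniform space
`X`: the supremum over the compact sets `K ⊆ X` and the entourages `U` of the exponential growth
rate (a `limsup`) of the minimal number of points which `(n, U)`-span `K` under `f`. -/
noncomputable def topEntropy {X : Type*} [UniformSpace X] (f : X → X) : EReal :=
  ⨆ (K : Set X) (_ : IsCompact K), Dynamics.coverEntropy f K

/-- The topological entropy of a self-map of a topological group, computed with respect to the
left uniformity of the group. -/
noncomputable def groupTopEntropy {G : Type*} [Group G] [TopologicalSpace G]
    [IsTopologicalGroup G] (f : G → G) : EReal :=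
  @topEntropy G (IsTopologicalGroup.leftUniformSpace G) f

/-- A subgroup `H` is `φ`-stable if `φ H = H`. -/
def IsStable {G : Type*} [Group G] [TopologicalSpace G] (φ : G ≃ₜ* G) (H : Subgroup G) : Prop :=
  H.map (φ.toMulEquiv : G →* G) = H

theorem IsStable.apply_mem {G : Type*} [Group G] [TopologicalSpace G] {φ : G ≃ₜ* G}
    {H : Subgroup G} (hH : IsStable φ H) {x : G} (hx : x ∈ H) : φ x ∈ H := by
  have h : φ x ∈ H.map (φ.toMulEquiv : G →* G) := ⟨x, hx, rfl⟩
  rwa [show H.map (φ.toMulEquiv : G →* G) = H from hH] at h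

theorem IsStable.symm_apply_mem {G : Type*} [Group G] [TopologicalSpace G] {φ : G ≃ₜ* G}
    {H : Subgroup G} (hH : IsStable φ H) {x : G} (hx : x ∈ H) : φ.symm x ∈ H := by
  have h : x ∈ H.map (φ.toMulEquiv : G →* G) := by
    rwa [show H.map (φ.toMulEquiv : G →* G) = H from hH]
  obtain ⟨y, hy, rfl⟩ := h
  have e : φ.symm (φ y) = y := φ.symm_apply_apply y
  exact e.symm ▸ hy

/-- The topological automorphism of a `φ`-stable subgroup `H` given by restriction of `φ`. -/
def restrictAut {G : Type*} [Group G] [TopologicalSpace G] (φ : G ≃ₜ* G) (H : Subgroup G)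
    (hH : IsStable φ H) : H ≃ₜ* H where
  toFun x := ⟨φ x, hH.apply_mem x.2⟩
  invFun x := ⟨φ.symm x, hH.symm_apply_mem x.2⟩
  left_inv x := Subtype.ext (φ.symm_apply_apply x)
  right_inv x := Subtype.ext (φ.apply_symm_apply x)
  map_mul' x y := Subtype.ext (map_mul φ (x : G) (y : G))
  continuous_toFun := (φ.continuous_toFun.comp continuous_subtype_val).subtype_mk _
  continuous_invFun := (φ.continuous_invFun.comp continuous_subtype_val).subtype_mk _

/-- The topological automorphism `x H ↦ φ x H` of `G ⧸ H` induced by `φ`, for a `φ`-stable normal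
subgroup `H`. -/
def quotientAut {G : Type*} [Group G] [TopologicalSpace G] (φ : G ≃ₜ* G) (H : Subgroup G)
    [H.Normal] (hH : IsStable φ H) : G ⧸ H ≃ₜ* G ⧸ H where
  toMulEquiv := QuotientGroup.congr H H φ.toMulEquiv hH
  continuous_toFun :=
    continuous_quot_lift _ (QuotientGroup.continuous_mk.comp φ.continuous_toFun)
  continuous_invFun :=
    continuous_quot_lift _ (QuotientGroup.continuous_mk.comp φ.continuous_invFun)

theorem quotientAut_mk {G : Type*} [Group G] [TopologicalSpace G] (φ : G ≃ₜ* G) (H : Subgroup G)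
    [H.Normal] (hH : IsStable φ H) (x : G) :
    quotientAut φ H hH (x : G ⧸ H) = ((φ x : G) : G ⧸ H) := rfl

/-! Entropy is reduced to indices: it is the supremum of `log [L : φ⁻¹L]` over the compact subgroups
`L` expanded by `φ` (`groupTopEntropy_eq_iSup`). Coset representatives of `φ⁻¹L` in `L` produce
exponentially many separated orbits; conversely, for `U` compact open, covering numbers grow at most
like powers of the index of `L = ⋂ φ^k U`, `k ≥ 0`. For `≤`, an expanded `L` yields the expanded
subgroups `L ∩ H` and `LH/H`, and its index is at most the product of theirs. For `≥`, separated
families in `H` and `G/H` multiply to a separated family in `G`, so no expanded subgroup of `G` has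
to be built from the two given ones. -/

section TopologicalEntropyAddition

open Set Filter Dynamics
open scoped Topology Pointwise ENNReal

/-! ### Relative indices (the value `0` encodes an infinite index). -/

namespace Subgroup

variable {G : Type*} [Group G]

theorem exists_transversal (H K : Subgroup G) (h : H.relIndex K ≠ 0) :
    ∃ r : Fin (H.relIndex K) → G, (∀ i, r i ∈ K) ∧ (∀ i j, i ≠ j → (r i)⁻¹ * r j ∉ H) ∧
      ∀ u ∈ K, ∃ i, u⁻¹ * r i ∈ H := by
  have : Finite (K ⧸ H.subgroupOf K) := Nat.finite_of_card_ne_zero h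
  let e : (K ⧸ H.subgroupOf K) ≃ Fin (H.relIndex K) := Finite.equivFinOfCardEq rfl
  have he : ∀ i, (((e.symm i).out : K) : K ⧸ H.subgroupOf K) = e.symm i :=
    fun i ↦ QuotientGroup.out_eq' _
  refine ⟨fun i ↦ ((e.symm i).out : K), fun i ↦ SetLike.coe_mem _, fun i j hij hmem ↦ hij ?_,
    fun u hu ↦ ⟨e (⟨u, hu⟩ : K), ?_⟩⟩
  · apply e.symm.injective
    rw [← he i, ← he j, QuotientGroup.eq]
    exact hmem
  · have := he (e (⟨u, hu⟩ : K))
    rw [e.symm_apply_apply, eq_comm, QuotientGroup.eq] at this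
    simpa [mem_subgroupOf] using this

/-- If `L` is contained in the product set `K H`, then `[L : L ∩ H] ≤ [K : K ∩ H]`. -/
theorem relIndex_le_of_subset_mul {H K L : Subgroup G} (hK : H.relIndex K ≠ 0) (hKL : K ≤ L)
    (hL : ∀ x ∈ L, ∃ k ∈ K, k⁻¹ * x ∈ H) : H.relIndex L ≠ 0 ∧ H.relIndex L ≤ H.relIndex K := by
  have : Finite (K ⧸ H.subgroupOf K) := Nat.finite_of_card_ne_zero hK
  have hs : Function.Surjective (quotientSubgroupOfEmbeddingOfLE H hKL) := by
    rintro ⟨x, hx⟩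
    obtain ⟨k, hk, hkx⟩ := hL x hx
    exact ⟨((⟨k, hk⟩ : K) : K ⧸ H.subgroupOf K), QuotientGroup.eq.2 hkx⟩
  have : Finite (L ⧸ H.subgroupOf L) := Finite.of_surjective _ hs
  exact ⟨Nat.card_pos.ne', Nat.card_le_card_of_surjective _ hs⟩

theorem relIndex_ne_zero_of_isOpen_of_isCompact [TopologicalSpace G] [IsTopologicalGroup G]
    {H K : Subgroup G} (hH : IsOpen (H : Set G)) (hK : IsCompact (K : Set G)) :
    H.relIndex K ≠ 0 := by
  have : CompactSpace K := isCompact_iff_compactSpace.1 hK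
  have : Finite (K ⧸ H.subgroupOf K) :=
    (H.subgroupOf K).quotient_finite_of_isOpen (hH.preimage continuous_subtype_val)
  exact Nat.card_pos.ne'

theorem relIndex_subgroupOf_ne_zero {M L : Subgroup G} (H : Subgroup G)
    (h : M.relIndex L ≠ 0) : (M.subgroupOf H).relIndex (L.subgroupOf H) ≠ 0 := by
  rw [subgroupOf, relIndex_comap, subgroupOf_map_subtype]
  exact fun h0 ↦ h (relIndex_eq_zero_of_le_right inf_le_left h0)

theorem relIndex_map_mk_ne_zero {M L : Subgroup G} (H : Subgroup G) [H.Normal]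
    (h : M.relIndex L ≠ 0) :
    (M.map (QuotientGroup.mk' H)).relIndex (L.map (QuotientGroup.mk' H)) ≠ 0 := by
  rw [relIndex_map_map, QuotientGroup.ker_mk']
  refine (relIndex_le_of_subset_mul (K := L)
    (fun h0 ↦ h (relIndex_eq_zero_of_le_left le_sup_left h0)) le_sup_left fun x hx ↦ ?_).1
  obtain ⟨l, hl, y, hy, rfl⟩ := mem_sup_of_normal_right.1 hx
  exact ⟨l, hl, mem_sup_right (by simpa using hy)⟩

/-- Split the index along `M ≤ L ∩ MH ≤ L`. By the modular law `L ∩ MH = (L ∩ H)M`, which bounds the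
lower index; the upper one is at most `[LH : MH]`. -/
theorem relIndex_le_relIndex_subgroupOf_mul_relIndex_map {M L : Subgroup G} (H : Subgroup G)
    [H.Normal] (hML : M ≤ L) (h : M.relIndex L ≠ 0) :
    M.relIndex L ≤ (M.subgroupOf H).relIndex (L.subgroupOf H) *
      (M.map (QuotientGroup.mk' H)).relIndex (L.map (QuotientGroup.mk' H)) := by
  have h0 := relIndex_map_mk_ne_zero H h
  have h1 := relIndex_subgroupOf_ne_zero H h
  rw [relIndex_map_map, QuotientGroup.ker_mk'] at h0 ⊢
  rw [subgroupOf, relIndex_comap, subgroupOf_map_subtype] at h1 ⊢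
  rw [← relIndex_mul_relIndex M (L ⊓ (M ⊔ H)) L (le_inf hML le_sup_left) inf_le_left]
  refine Nat.mul_le_mul (relIndex_le_of_subset_mul h1 (inf_le_inf_left _ le_sup_right) ?_).2 ?_
  · rintro x ⟨hxL, hx⟩
    rw [SetLike.mem_coe, sup_comm] at hx
    obtain ⟨y, hy, m, hm, rfl⟩ := mem_sup_of_normal_left.1 hx
    exact ⟨y, ⟨(mul_mem_cancel_right (hML hm)).1 hxL, hy⟩, by simpa using hm⟩
  · rw [inf_relIndex_left]
    exact relIndex_le_of_le_right le_sup_left h0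

end Subgroup

/-- Van Dantzig's theorem. -/
theorem exists_isOpen_isCompact_subgroup_subset {G : Type*} [Group G] [TopologicalSpace G]
    [IsTopologicalGroup G] [T2Space G] [LocallyCompactSpace G] [TotallyDisconnectedSpace G]
    {W : Set G} (hW : W ∈ 𝓝 (1 : G)) :
    ∃ U : Subgroup G, IsOpen (U : Set G) ∧ IsCompact (U : Set G) ∧ (U : Set G) ⊆ W := by
  obtain ⟨C, hC, hCW, hCc⟩ := local_compact_nhds hW
  obtain ⟨V, hVo, hV1, hVC⟩ := loc_compact_Haus_tot_disc_of_zero_dim.mem_nhds_iff.1 hC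
  have hVc : IsCompact V := hCc.of_isClosed_subset hVo.1 hVC
  obtain ⟨T, hT, hVT⟩ := compact_open_separated_mul_right hVc hVo.2 Subset.rfl
  -- Right translation by the generated subgroup preserves `V`; as `1 ∈ V`, that subgroup lies in
  -- `V`.
  have hmul : ∀ x ∈ Subgroup.closure (T ∩ T⁻¹), ∀ v ∈ V, v * x ∈ V := by
    intro x hx
    induction hx using Subgroup.closure_induction_left with
    | one => simp
    | mul_left x hx y _ ih =>
      exact fun v hv ↦ mul_assoc v x y ▸ ih _ (hVT (mul_mem_mul hv hx.1))
    | inv_mul_cancel x hx y _ ih =>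
      exact fun v hv ↦ mul_assoc v x⁻¹ y ▸ ih _ (hVT (mul_mem_mul hv hx.2))
  have hsub : (Subgroup.closure (T ∩ T⁻¹) : Set G) ⊆ V := fun x hx ↦ by
    simpa using hmul x hx 1 hV1
  have hopen : IsOpen (Subgroup.closure (T ∩ T⁻¹) : Set G) :=
    Subgroup.isOpen_of_mem_nhds _ (g := 1)
      (mem_of_superset (inter_mem hT (inv_mem_nhds_one G hT)) Subgroup.subset_closure)
  exact ⟨_, hopen, hVc.of_isClosed_subset (Subgroup.isClosed_of_isOpen _ hopen) hsub,
    hsub.trans (hVC.trans hCW)⟩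

/-! ### Expanded subgroups and the lower bound for entropy. -/

variable {G : Type*} [Group G] [TopologicalSpace G]

/-- A compact subgroup `L` is expanded by `φ` if `φ⁻¹ L` is a subgroup of finite index of `L`. -/
structure IsExpanded (φ : G ≃ₜ* G) (L : Subgroup G) : Prop where
  isCompact : IsCompact (L : Set G)
  comap_le : L.comap (φ.toMulEquiv : G →* G) ≤ L
  relIndex_ne_zero : (L.comap (φ.toMulEquiv : G →* G)).relIndex L ≠ 0

/-- The index `[L : φ⁻¹ L]`. -/
noncomputable def expansionIndex (φ : G ≃ₜ* G) (L : Subgroup G) : ℕ :=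
  (L.comap (φ.toMulEquiv : G →* G)).relIndex L

/-- A family of points of `G` whose `φ`-orbits of length `n` are pairwise `W`-apart. -/
def IsSeparatedFamily (φ : G ≃ₜ* G) (W : Set G) (n : ℕ) {ι : Type*} (f : ι → G) : Prop :=
  ∀ i j, i ≠ j → ∃ k < n, φ^[k] ((f i)⁻¹ * f j) ∉ W

theorem IsExpanded.exists_nhds_separatedFamily [IsTopologicalGroup G] [T2Space G] {φ : G ≃ₜ* G}
    {L : Subgroup G} (hL : IsExpanded φ L) :
    ∃ W ∈ 𝓝 (1 : G), ∀ n : ℕ, ∃ f : Fin (expansionIndex φ L ^ n) → G,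
      (∀ i, f i ∈ L) ∧ IsSeparatedFamily φ W n f := by
  let M := L.comap (φ.toMulEquiv : G →* G)
  have hMmem : ∀ x, x ∈ M ↔ φ x ∈ L := fun _ ↦ Iff.rfl
  -- A closed subgroup of finite index is open, so `M` is open in `L`.
  obtain ⟨W, hW, hWM⟩ : ∃ W ∈ 𝓝 (1 : G), ∀ x ∈ L, x ∈ W → x ∈ M := by
    have hcl : IsClosed (M : Set G) := hL.isCompact.isClosed.preimage φ.continuous_toFun
    have : (M.subgroupOf L).FiniteIndex := ⟨hL.relIndex_ne_zero⟩
    have hop := (M.subgroupOf L).isOpen_of_isClosed_of_finiteIndex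
      (hcl.preimage continuous_subtype_val)
    obtain ⟨W, hWo, hWM⟩ := isOpen_induced_iff.1 hop
    refine ⟨W, hWo.mem_nhds ?_, fun x hx hxW ↦ ?_⟩
    · have : (1 : L) ∈ Subtype.val ⁻¹' W := hWM ▸ (M.subgroupOf L).one_mem
      exact this
    · have : (⟨x, hx⟩ : L) ∈ ((M.subgroupOf L : Subgroup L) : Set L) := hWM ▸ hxW
      exact this
  refine ⟨W, hW, fun n ↦ ?_⟩
  obtain ⟨r, hrL, hr, -⟩ := Subgroup.exists_transversal M L hL.relIndex_ne_zero
  induction n with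
  | zero =>
    refine ⟨fun _ ↦ 1, fun _ ↦ L.one_mem, fun i j hij ↦ absurd ?_ hij⟩
    have : Subsingleton (Fin (expansionIndex φ L ^ 0)) := by rw [pow_zero]; infer_instance
    exact Subsingleton.elim _ _
  | succ n ih =>
    obtain ⟨f, hfL, hf⟩ := ih
    have hfM : ∀ i, φ.symm (f i) ∈ M := fun i ↦ by
      rw [hMmem, φ.apply_symm_apply]; exact hfL i
    let e : Fin (expansionIndex φ L ^ (n + 1)) ≃
        Fin (expansionIndex φ L ^ n) × Fin (expansionIndex φ L) :=
      (finCongr (pow_succ _ _)).trans finProdFinEquiv.symm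
    let r : Fin (expansionIndex φ L) → G := r
    -- Distinct cosets of `M` are told apart at time `0`; within one coset `φ` recovers the family
    -- of length `n`, one step later.
    refine ⟨fun i ↦ r (e i).2 * φ.symm (f (e i).1),
      fun i ↦ mul_mem (hrL _) (hL.comap_le (hfM _)), fun i j hij ↦ ?_⟩
    by_cases h2 : (e i).2 = (e j).2
    · have h1 : (e i).1 ≠ (e j).1 := fun h1 ↦ hij (e.injective (Prod.ext h1 h2))
      obtain ⟨k, hk, hkW⟩ := hf _ _ h1
      refine ⟨k + 1, by omega, ?_⟩
      rw [Function.iterate_succ_apply]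
      convert hkW using 3
      simp [h2, mul_assoc]
    · refine ⟨0, by omega, fun hmem ↦ hr _ _ h2 ?_⟩
      have := hWM _ (mul_mem (inv_mem (mul_mem (hrL _) (hL.comap_le (hfM _))))
        (mul_mem (hrL _) (hL.comap_le (hfM _)))) hmem
      have := mul_mem (mul_mem (hfM (e i).1) this) (inv_mem (hfM (e j).1))
      simpa [mul_assoc] using this

theorem log_le_groupTopEntropy [IsTopologicalGroup G] (φ : G ≃ₜ* G) {K W : Set G}
    (hK : IsCompact K) (hW : W ∈ 𝓝 (1 : G)) (s : ℕ)
    (h : ∀ n : ℕ, ∃ f : Fin (s ^ n) → G, (∀ i, f i ∈ K) ∧ IsSeparatedFamily φ W n f) :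
    ENNReal.log (s : ℝ≥0∞) ≤ groupTopEntropy φ := by
  let := IsTopologicalGroup.leftUniformSpace G
  -- Nets require disjoint dynamical balls, hence a `V` with `V V⁻¹ ⊆ W`.
  obtain ⟨V, hV, hVW⟩ := exists_nhds_split_inv hW
  let U : SetRel G G := {p | p.1⁻¹ * p.2 ∈ V}
  have hU : U ∈ uniformity G := preimage_mem_comap hV
  refine le_trans ?_ (le_iSup₂_of_le (f := fun (K : Set G) (_ : IsCompact K) ↦ coverEntropy φ K)
    K hK (netEntropyEntourage_le_coverEntropy _ _ hU))
  rw [← ExpGrowth.expGrowthSup_pow]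
  refine ExpGrowth.expGrowthSup_monotone fun n ↦ ?_
  obtain ⟨f, hfK, hf⟩ := h n
  have hinj : Function.Injective f := fun i j hij ↦ by
    by_contra hne
    obtain ⟨k, -, hk⟩ := hf i j hne
    rw [hij, inv_mul_cancel, iterate_map_one] at hk
    exact hk (mem_of_mem_nhds hW)
  have hnet : IsDynNetIn φ K U n (Finset.univ.map ⟨f, hinj⟩ : Finset G) := by
    refine ⟨by simpa [Set.range_subset_iff] using hfK, ?_⟩
    simp only [Finset.coe_map, Finset.coe_univ, image_univ, Function.Embedding.coeFn_mk]
    rintro _ ⟨i, rfl⟩ _ ⟨j, rfl⟩ hij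
    refine Set.disjoint_left.2 fun z hzi hzj ↦ ?_
    obtain ⟨k, hkn, hk⟩ := hf i j (fun h ↦ hij (h ▸ rfl))
    have h1 : (φ^[k] (f i))⁻¹ * φ^[k] z ∈ V := mem_dynEntourage.1 hzi k hkn
    have h2 : (φ^[k] (f j))⁻¹ * φ^[k] z ∈ V := mem_dynEntourage.1 hzj k hkn
    apply hk
    rw [iterate_map_mul, iterate_map_inv]
    convert hVW _ h1 _ h2 using 1
    simp [div_eq_mul_inv, mul_assoc]
  have := hnet.card_le_netMaxcard
  rw [Finset.card_map, Finset.card_univ, Fintype.card_fin] at this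
  have h2 : ((s ^ n : ℕ) : ℝ≥0∞) ≤ (netMaxcard φ K U n : ℕ∞) := by
    rw [← ENat.toENNReal_coe]
    exact ENat.toENNReal_mono this
  simpa using h2

theorem IsExpanded.log_le_groupTopEntropy [IsTopologicalGroup G] [T2Space G] {φ : G ≃ₜ* G}
    {L : Subgroup G} (hL : IsExpanded φ L) :
    ENNReal.log (expansionIndex φ L : ℝ≥0∞) ≤ groupTopEntropy φ :=
  let ⟨_, hW, h⟩ := hL.exists_nhds_separatedFamily
  _root_.log_le_groupTopEntropy φ hL.isCompact hW _ h

/-! ### Orbits staying in a compact open subgroup, and the upper bound. -/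

/-- The elements of `G` whose iterates under `φ` at all times in `s` lie in `U`. -/
def stayingSubgroup (φ : G ≃ₜ* G) (U : Subgroup G) (s : Set ℕ) : Subgroup G where
  carrier := {x | ∀ k ∈ s, φ^[k] x ∈ U}
  mul_mem' hx hy k hk := by rw [iterate_map_mul]; exact mul_mem (hx k hk) (hy k hk)
  one_mem' k _ := by rw [iterate_map_one]; exact one_mem U
  inv_mem' hx k hk := by rw [iterate_map_inv]; exact inv_mem (hx k hk)

theorem mem_stayingSubgroup {φ : G ≃ₜ* G} {U : Subgroup G} {s : Set ℕ} {x : G} :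
    x ∈ stayingSubgroup φ U s ↔ ∀ k ∈ s, φ^[k] x ∈ U := Iff.rfl

theorem stayingSubgroup_anti (φ : G ≃ₜ* G) (U : Subgroup G) {s t : Set ℕ} (h : s ⊆ t) :
    stayingSubgroup φ U t ≤ stayingSubgroup φ U s := fun _ hx k hk ↦ hx k (h hk)

theorem coe_stayingSubgroup (φ : G ≃ₜ* G) (U : Subgroup G) (s : Set ℕ) :
    (stayingSubgroup φ U s : Set G) = ⋂ k ∈ s, φ^[k] ⁻¹' U := by
  ext x; simp [mem_stayingSubgroup]

theorem isOpen_stayingSubgroup {φ : G ≃ₜ* G} {U : Subgroup G} (hU : IsOpen (U : Set G))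
    {s : Set ℕ} (hs : s.Finite) : IsOpen (stayingSubgroup φ U s : Set G) := by
  rw [coe_stayingSubgroup]
  exact hs.isOpen_biInter fun k _ ↦ hU.preimage (φ.continuous_toFun.iterate k)

theorem isCompact_stayingSubgroup [T2Space G] {φ : G ≃ₜ* G} {U : Subgroup G}
    (hU : IsCompact (U : Set G)) {s : Set ℕ} (hs : 0 ∈ s) :
    IsCompact (stayingSubgroup φ U s : Set G) := by
  refine hU.of_isClosed_subset ?_ fun x hx ↦ hx 0 hs
  rw [coe_stayingSubgroup]
  exact isClosed_biInter fun k _ ↦ hU.isClosed.preimage (φ.continuous_toFun.iterate k)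

theorem comap_stayingSubgroup_symm_univ_inf (φ : G ≃ₜ* G) (U : Subgroup G) :
    (stayingSubgroup φ.symm U univ).comap (φ.toMulEquiv : G →* G) ⊓
        stayingSubgroup φ.symm U univ =
      U.comap (φ.toMulEquiv : G →* G) ⊓ stayingSubgroup φ.symm U univ := by
  ext x
  refine and_congr_left fun hx ↦ ⟨fun h ↦ h 0 (mem_univ _), fun h k _ ↦ ?_⟩
  cases k with
  | zero => exact h
  | succ k =>
    rw [Function.iterate_succ_apply]
    exact (φ.symm_apply_apply x).symm ▸ hx k (mem_univ _)

theorem expansionIndex_stayingSubgroup (φ : G ≃ₜ* G) (U : Subgroup G) :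
    expansionIndex φ (stayingSubgroup φ.symm U univ) =
      (U.comap (φ.toMulEquiv : G →* G)).relIndex (stayingSubgroup φ.symm U univ) := by
  rw [expansionIndex, ← Subgroup.inf_relIndex_right, comap_stayingSubgroup_symm_univ_inf,
    Subgroup.inf_relIndex_right]

theorem isExpanded_stayingSubgroup [IsTopologicalGroup G] [T2Space G] (φ : G ≃ₜ* G)
    {U : Subgroup G} (hUo : IsOpen (U : Set G)) (hUc : IsCompact (U : Set G)) :
    IsExpanded φ (stayingSubgroup φ.symm U univ) where
  isCompact := isCompact_stayingSubgroup hUc (mem_univ 0)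
  comap_le x hx k _ := by
    have := hx (k + 1) (mem_univ _)
    rwa [Function.iterate_succ_apply, show φ.symm ((φ.toMulEquiv : G →* G) x) = x from
      φ.symm_apply_apply x] at this
  relIndex_ne_zero := by
    change expansionIndex _ _ ≠ 0
    rw [expansionIndex_stayingSubgroup]
    exact Subgroup.relIndex_ne_zero_of_isOpen_of_isCompact (hUo.preimage φ.continuous_toFun)
      (isCompact_stayingSubgroup hUc (mem_univ 0))

/-- The compact groups `⋂_{k ≤ n} φ^k U` decrease to `L = ⋂ φ^k U`, so they eventually enter the
open set `L · φ⁻¹U`. -/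
theorem exists_relIndex_stayingSubgroup_le [IsTopologicalGroup G] [T2Space G] (φ : G ≃ₜ* G)
    {U : Subgroup G} (hUo : IsOpen (U : Set G)) (hUc : IsCompact (U : Set G)) :
    ∃ N, ∀ n ≥ N, (U.comap (φ.toMulEquiv : G →* G)).relIndex
        (stayingSubgroup φ.symm U (Iic n)) ≤
      expansionIndex φ (stayingSubgroup φ.symm U univ) := by
  have hVo : IsOpen (U.comap (φ.toMulEquiv : G →* G) : Set G) := hUo.preimage φ.continuous_toFun
  obtain ⟨N, hN⟩ := exists_subset_nhds_of_isCompact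
    (V := fun n ↦ (stayingSubgroup φ.symm U (Iic n) : Set G))
    (U := (stayingSubgroup φ.symm U univ : Set G) * (U.comap (φ.toMulEquiv : G →* G) : Set G))
    (Antitone.directed_ge fun m n h ↦ stayingSubgroup_anti _ _ (Iic_subset_Iic.2 h))
    (fun n ↦ isCompact_stayingSubgroup hUc (mem_Iic.2 n.zero_le))
    (fun x hx ↦ by
      refine hVo.mul_left.mem_nhds ⟨x, fun k _ ↦ ?_, 1, one_mem _, mul_one x⟩
      exact mem_iInter.1 hx k k (mem_Iic.2 le_rfl))
  refine ⟨N, fun n hn ↦ ?_⟩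
  rw [expansionIndex_stayingSubgroup]
  refine (Subgroup.relIndex_le_of_subset_mul
    (Subgroup.relIndex_ne_zero_of_isOpen_of_isCompact hVo
      (isCompact_stayingSubgroup hUc (mem_univ 0)))
    (stayingSubgroup_anti _ _ (subset_univ _)) fun x hx ↦ ?_).2
  obtain ⟨k, hk, y, hy, rfl⟩ := hN (stayingSubgroup_anti _ _ (Iic_subset_Iic.2 hn) hx)
  exact ⟨k, hk, by simpa using hy⟩

/-- Apply `φ^n`: staying in `U` at times `0, …, n` becomes staying in `U` under `φ⁻¹`, and the new
condition at time `n + 1` becomes membership in `φ⁻¹U`. -/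
theorem relIndex_stayingSubgroup_succ_le [IsTopologicalGroup G] [T2Space G] (φ : G ≃ₜ* G)
    {U : Subgroup G} (hUo : IsOpen (U : Set G)) (hUc : IsCompact (U : Set G)) (n : ℕ) :
    (stayingSubgroup φ U (Iic (n + 1))).relIndex (stayingSubgroup φ U (Iic n)) ≤
      (U.comap (φ.toMulEquiv : G →* G)).relIndex (stayingSubgroup φ.symm U (Iic n)) := by
  obtain ⟨f, hf⟩ : ∃ f : G →* G, ⇑f = φ^[n] :=
    ⟨⟨⟨φ^[n], iterate_map_one φ n⟩, iterate_map_mul φ n⟩, rfl⟩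
  have h : stayingSubgroup φ U (Iic (n + 1)) =
      (U.comap (φ.toMulEquiv : G →* G)).comap f ⊓ stayingSubgroup φ U (Iic n) := by
    ext x
    have hx : x ∈ (U.comap (φ.toMulEquiv : G →* G)).comap f ↔ φ^[n + 1] x ∈ U := by
      rw [Function.iterate_succ_apply', ← hf]; rfl
    rw [Subgroup.mem_inf, hx, mem_stayingSubgroup, mem_stayingSubgroup]
    refine ⟨fun h ↦ ⟨h _ (mem_Iic.2 le_rfl), fun k hk ↦ h k (le_trans hk n.le_succ)⟩,
      fun h k hk ↦ ?_⟩
    rcases Nat.le_succ_iff.1 (mem_Iic.1 hk) with hk | rfl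
    exacts [h.2 k hk, h.1]
  rw [h, Subgroup.inf_relIndex_right, Subgroup.relIndex_comap]
  refine Subgroup.relIndex_le_of_le_right ?_
    (Subgroup.relIndex_ne_zero_of_isOpen_of_isCompact (hUo.preimage φ.continuous_toFun)
      (isCompact_stayingSubgroup hUc (mem_Iic.2 n.zero_le)))
  rintro _ ⟨x, hx, rfl⟩ k hk
  obtain ⟨m, rfl⟩ := Nat.exists_eq_add_of_le (mem_Iic.1 hk)
  rw [hf, Function.iterate_add_apply,
    (Function.LeftInverse.iterate φ.symm_apply_apply k : Function.LeftInverse _ _)]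
  exact hx m (mem_Iic.2 (by omega))

theorem relIndex_stayingSubgroup_add_le [IsTopologicalGroup G] [T2Space G] (φ : G ≃ₜ* G)
    {U : Subgroup G} (hUo : IsOpen (U : Set G)) (hUc : IsCompact (U : Set G)) :
    ∃ N, ∀ m, (stayingSubgroup φ U (Iic (N + m))).relIndex (stayingSubgroup φ U (Iic N)) ≤
      expansionIndex φ (stayingSubgroup φ.symm U univ) ^ m := by
  obtain ⟨N, hN⟩ := exists_relIndex_stayingSubgroup_le φ hUo hUc
  refine ⟨N, fun m ↦ ?_⟩
  induction m with
  | zero => simp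
  | succ m ih =>
    rw [← Subgroup.relIndex_mul_relIndex _ (stayingSubgroup φ U (Iic (N + m))) _
      (stayingSubgroup_anti _ _ (Iic_subset_Iic.2 (by omega)))
      (stayingSubgroup_anti _ _ (Iic_subset_Iic.2 (by omega))), pow_succ, mul_comm]
    exact Nat.mul_le_mul ih ((relIndex_stayingSubgroup_succ_le φ hUo hUc (N + m)).trans
      (hN _ (by omega)))

theorem exists_coverMincard_le [IsTopologicalGroup G] [T2Space G] (φ : G ≃ₜ* G)
    {U : Subgroup G} (hUo : IsOpen (U : Set G)) (hUc : IsCompact (U : Set G)) {K : Set G}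
    (hK : IsCompact K) : ∃ N C : ℕ, ∀ m, coverMincard φ K {p | p.1⁻¹ * p.2 ∈ U} (N + m) ≤
      (C * expansionIndex φ (stayingSubgroup φ.symm U univ) ^ m : ℕ) := by
  classical
  obtain ⟨N, hN⟩ := relIndex_stayingSubgroup_add_le φ hUo hUc
  have hopen (n : ℕ) : IsOpen (stayingSubgroup φ U (Iic n) : Set G) :=
    isOpen_stayingSubgroup hUo (finite_Iic n)
  obtain ⟨t, -, ht⟩ := hK.elim_nhds_subcover
    (fun x ↦ x • (stayingSubgroup φ U (Iic N) : Set G))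
    fun x _ ↦ ((hopen N).smul x).mem_nhds ⟨1, one_mem _, mul_one x⟩
  -- The translates covering `K` depend only on `N`; each is then cut into cosets.
  refine ⟨N, t.card, fun m ↦ ?_⟩
  obtain ⟨r, -, -, hr⟩ := Subgroup.exists_transversal (stayingSubgroup φ U (Iic (N + m)))
    (stayingSubgroup φ U (Iic N)) (Subgroup.relIndex_ne_zero_of_isOpen_of_isCompact (hopen _)
      (isCompact_stayingSubgroup hUc (mem_Iic.2 N.zero_le)))
  let S : Finset G := (t ×ˢ Finset.univ).image fun p ↦ p.1 * r p.2
  have hS : IsDynCoverOf φ K {p | p.1⁻¹ * p.2 ∈ U} (N + m) S := by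
    intro x hx
    obtain ⟨g, hg, u, hu, rfl⟩ := mem_iUnion₂.1 (ht hx)
    obtain ⟨i, hi⟩ := hr u hu
    refine ⟨g * r i, Finset.mem_coe.2 (Finset.mem_image.2
      ⟨(g, i), Finset.mem_product.2 ⟨hg, Finset.mem_univ _⟩, rfl⟩), ?_⟩
    refine mem_dynEntourage.2 fun k hk ↦ ?_
    -- `Iic (N + m)` controls one time more than needed, which is harmless.
    have := hi k (mem_Iic.2 hk.le)
    rw [mem_ofPred_eq, ← iterate_map_inv, ← iterate_map_mul]
    simpa [mul_assoc] using this
  refine hS.coverMincard_le_card.trans (Nat.cast_le.2 (Finset.card_image_le.trans ?_))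
  rw [Finset.card_product, Finset.card_univ, Fintype.card_fin]
  exact Nat.mul_le_mul_left _ (hN m)

theorem coverEntropyEntourage_le_log_expansionIndex [IsTopologicalGroup G] [T2Space G]
    (φ : G ≃ₜ* G) {U : Subgroup G} (hUo : IsOpen (U : Set G)) (hUc : IsCompact (U : Set G))
    {K : Set G} (hK : IsCompact K) :
    coverEntropyEntourage φ K {p | p.1⁻¹ * p.2 ∈ U} ≤
      ENNReal.log (expansionIndex φ (stayingSubgroup φ.symm U univ) : ℝ≥0∞) := by
  obtain ⟨N, C, h⟩ := exists_coverMincard_le φ hUo hUc hK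
  have hs := Nat.pos_of_ne_zero (isExpanded_stayingSubgroup φ hUo hUc).relIndex_ne_zero
  rw [← ExpGrowth.expGrowthSup_pow]
  refine ExpGrowth.expGrowthSup_le_of_eventually_le (ENNReal.natCast_ne_top C)
    (eventually_atTop.2 ⟨N, fun n hn ↦ ?_⟩)
  obtain ⟨m, rfl⟩ := Nat.exists_eq_add_of_le hn
  have h1 := (h m).trans (Nat.cast_le.2 (Nat.mul_le_mul_left C
    (Nat.pow_le_pow_right hs (Nat.le_add_left m N))))
  have h2 := ENat.toENNReal_mono h1
  rw [ENat.toENNReal_coe] at h2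
  exact_mod_cast h2

/-- The topological entropy is computed by the indices of the expanded compact subgroups, provided
that the compact open subgroups form a neighbourhood base at `1`. -/
theorem groupTopEntropy_eq_iSup [IsTopologicalGroup G] [T2Space G] (φ : G ≃ₜ* G)
    (hG : ∀ W ∈ 𝓝 (1 : G),
      ∃ U : Subgroup G, IsOpen (U : Set G) ∧ IsCompact (U : Set G) ∧ (U : Set G) ⊆ W) :
    groupTopEntropy φ =
      ⨆ (L : Subgroup G) (_ : IsExpanded φ L), ENNReal.log (expansionIndex φ L : ℝ≥0∞) := by
  refine le_antisymm (iSup₂_le fun K hK ↦ iSup₂_le fun V hV ↦ ?_)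
    (iSup₂_le fun L hL ↦ hL.log_le_groupTopEntropy)
  obtain ⟨W, hW, hWV⟩ := mem_comap.1 hV
  obtain ⟨U, hUo, hUc, hUW⟩ := hG W hW
  refine (coverEntropyEntourage_antitone φ K ?_).trans
    ((coverEntropyEntourage_le_log_expansionIndex φ hUo hUc hK).trans
      (le_iSup₂_of_le _ (isExpanded_stayingSubgroup φ hUo hUc) le_rfl))
  exact fun p hp ↦ hWV (hUW hp)

/-! ### Passage to `H` and `G ⧸ H`. -/

theorem exists_isCompact_image_quotientMk [IsTopologicalGroup G] [LocallyCompactSpace G]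
    (H : Subgroup G) {M : Set (G ⧸ H)}
    (hM : IsCompact M) : ∃ K : Set G, IsCompact K ∧ M ⊆ (↑) '' K := by
  choose C hC hCn using fun q : G ⧸ H ↦ exists_compact_mem_nhds q.out
  obtain ⟨t, -, ht⟩ := hM.elim_nhds_subcover (fun q ↦ ((↑) : G → G ⧸ H) '' C q) fun q _ ↦ by
    have := (QuotientGroup.isOpenMap_coe (N := H)).image_mem_nhds (hCn q)
    rwa [QuotientGroup.out_eq'] at this
  refine ⟨⋃ q ∈ t, C q, t.isCompact_biUnion fun q _ ↦ hC q, ?_⟩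
  simpa [image_iUnion] using ht

variable (φ : G ≃ₜ* G) (H : Subgroup G)
  (hH : IsStable φ H)

theorem coe_iterate_restrictAut (k : ℕ) (x : H) :
    (((restrictAut φ H hH)^[k] x : H) : G) = φ^[k] x :=
  Function.Semiconj.iterate_right (f := ((↑) : H → G)) (fun _ ↦ rfl) k x

theorem iterate_quotientAut_mk [H.Normal] (k : ℕ) (x : G) :
    (quotientAut φ H hH)^[k] (x : G ⧸ H) = ((φ^[k] x : G) : G ⧸ H) :=
  (Function.Semiconj.iterate_right (f := ((↑) : G → G ⧸ H)) (fun _ ↦ rfl) k x).symm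

theorem comap_subgroupOf_restrictAut (L : Subgroup G) :
    (L.subgroupOf H).comap ((restrictAut φ H hH).toMulEquiv : H →* H) =
      (L.comap (φ.toMulEquiv : G →* G)).subgroupOf H := rfl

theorem comap_map_quotientAut [H.Normal] (L : Subgroup G) :
    (L.map (QuotientGroup.mk' H)).comap
        ((quotientAut φ H hH).toMulEquiv : G ⧸ H →* G ⧸ H) =
      (L.comap (φ.toMulEquiv : G →* G)).map (QuotientGroup.mk' H) := by
  ext q
  obtain ⟨x, rfl⟩ := QuotientGroup.mk_surjective q
  constructor
  · rintro ⟨l, hl, hlx⟩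
    have hlx : ((l : G) : G ⧸ H) = (φ x : G) := hlx
    refine ⟨φ.symm l, ?_, QuotientGroup.eq.2 ?_⟩
    · change φ (φ.symm l) ∈ L
      rwa [φ.apply_symm_apply]
    · simpa using hH.symm_apply_mem (QuotientGroup.eq.1 hlx)
  · rintro ⟨l, hl, hlx⟩
    refine ⟨φ l, hl, ?_⟩
    have := congrArg (quotientAut φ H hH) hlx
    exact this

variable {φ}

theorem IsExpanded.subgroupOf (hHc : IsClosed (H : Set G)) {L : Subgroup G}
    (hL : IsExpanded φ L) : IsExpanded (restrictAut φ H hH) (L.subgroupOf H) where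
  isCompact := hHc.isClosedEmbedding_subtypeVal.isCompact_preimage hL.isCompact
  comap_le := by
    rw [comap_subgroupOf_restrictAut]
    exact Subgroup.comap_mono hL.comap_le
  relIndex_ne_zero := by
    rw [comap_subgroupOf_restrictAut]
    exact Subgroup.relIndex_subgroupOf_ne_zero H hL.relIndex_ne_zero

theorem IsExpanded.map_mk [H.Normal] {L : Subgroup G} (hL : IsExpanded φ L) :
    IsExpanded (quotientAut φ H hH) (L.map (QuotientGroup.mk' H)) where
  isCompact := hL.isCompact.image QuotientGroup.continuous_mk
  comap_le := by
    rw [comap_map_quotientAut]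
    exact Subgroup.map_mono hL.comap_le
  relIndex_ne_zero := by
    rw [comap_map_quotientAut]
    exact Subgroup.relIndex_map_mk_ne_zero H hL.relIndex_ne_zero

theorem IsExpanded.expansionIndex_le_mul [H.Normal] {L : Subgroup G} (hL : IsExpanded φ L) :
    expansionIndex φ L ≤ expansionIndex (restrictAut φ H hH) (L.subgroupOf H) *
      expansionIndex (quotientAut φ H hH) (L.map (QuotientGroup.mk' H)) := by
  rw [expansionIndex, expansionIndex, expansionIndex, comap_map_quotientAut,
    comap_subgroupOf_restrictAut]
  exact Subgroup.relIndex_le_relIndex_subgroupOf_mul_relIndex_map H hL.comap_le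
    hL.relIndex_ne_zero

theorem log_expansionIndex_add_le_groupTopEntropy [IsTopologicalGroup G] [T2Space G]
    [LocallyCompactSpace G] [H.Normal] (hHc : IsClosed (H : Set G)) {L : Subgroup H}
    {M : Subgroup (G ⧸ H)} (hL : IsExpanded (restrictAut φ H hH) L)
    (hM : IsExpanded (quotientAut φ H hH) M) :
    ENNReal.log (expansionIndex (restrictAut φ H hH) L : ℝ≥0∞) +
      ENNReal.log (expansionIndex (quotientAut φ H hH) M : ℝ≥0∞) ≤ groupTopEntropy φ := by
  -- Closedness of `H` makes `G ⧸ H` Hausdorff.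
  have : IsClosed (H : Set G) := hHc
  obtain ⟨W₁, hW₁, hf⟩ := hL.exists_nhds_separatedFamily
  obtain ⟨W₂, hW₂, hg⟩ := hM.exists_nhds_separatedFamily
  obtain ⟨V, hV, hVW⟩ := mem_nhds_subtype _ _ _ |>.1 hW₁
  obtain ⟨K, hK, hMK⟩ := exists_isCompact_image_quotientMk H hM.isCompact
  have hW : V ∩ ((↑) : G → G ⧸ H) ⁻¹' W₂ ∈ 𝓝 (1 : G) :=
    inter_mem hV (QuotientGroup.continuous_mk.continuousAt.preimage_mem_nhds hW₂)
  rw [← ENNReal.log_mul_add, ← Nat.cast_mul]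
  refine log_le_groupTopEntropy φ (hK.mul (hL.isCompact.image continuous_subtype_val)) hW _
    fun n ↦ ?_
  obtain ⟨f, hfL, hf⟩ := hf n
  obtain ⟨g, hgM, hg⟩ := hg n
  choose x hxK hxg using fun j ↦ hMK (hgM j)
  let e := (finCongr (mul_pow (expansionIndex (restrictAut φ H hH) L)
    (expansionIndex (quotientAut φ H hH) M) n)).trans finProdFinEquiv.symm
  refine ⟨fun i ↦ x (e i).2 * f (e i).1, fun i ↦ mul_mem_mul (hxK _) ⟨_, hfL _, rfl⟩,
    fun i j hij ↦ ?_⟩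
  -- With equal lifts these cancel and the `H`-factors separate; otherwise the `H`-factors die in `G
  -- ⧸ H`, where the lifts separate.
  by_cases h2 : (e i).2 = (e j).2
  · have h1 : (e i).1 ≠ (e j).1 := fun h1 ↦ hij (e.injective (Prod.ext h1 h2))
    obtain ⟨k, hk, hkW⟩ := hf _ _ h1
    refine ⟨k, hk, fun hmem ↦ hkW (hVW ?_)⟩
    rw [mem_preimage, coe_iterate_restrictAut]
    simpa [h2, mul_assoc] using hmem.1
  · obtain ⟨k, hk, hkW⟩ := hg _ _ h2
    refine ⟨k, hk, fun hmem ↦ hkW ?_⟩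
    rw [← hxg, ← hxg, ← QuotientGroup.mk_inv, ← QuotientGroup.mk_mul]
    have := hmem.2
    rw [mem_preimage, ← iterate_quotientAut_mk φ H hH] at this
    have hf1 (l : H) : ((l : G) : G ⧸ H) = 1 := (QuotientGroup.eq_one_iff _).2 l.2
    simpa [hf1] using this

end TopologicalEntropyAddition

/-! ### The addition formula. -/

theorem mainTheorem2 {G : Type*} [Group G] [TopologicalSpace G] [IsTopologicalGroup G]
    [T2Space G] [LocallyCompactSpace G] [TotallyDisconnectedSpace G]
    (φ : G ≃ₜ* G) (H : Subgroup G) [H.Normal] (hclosed : IsClosed (H : Set G))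
    (hstable : IsStable φ H) :
    groupTopEntropy φ =
      groupTopEntropy (restrictAut φ H hstable) + groupTopEntropy (quotientAut φ H hstable) := by
  have hG : ∀ W ∈ nhds (1 : G), ∃ U : Subgroup G, IsOpen (U : Set G) ∧ IsCompact (U : Set G) ∧
      (U : Set G) ⊆ W := fun W hW ↦ exists_isOpen_isCompact_subgroup_subset hW
  have hHb : ∀ W ∈ nhds (1 : H), ∃ U : Subgroup H, IsOpen (U : Set H) ∧ IsCompact (U : Set H) ∧
      (U : Set H) ⊆ W := fun W hW ↦ by
    have : LocallyCompactSpace H := hclosed.locallyCompactSpace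
    exact exists_isOpen_isCompact_subgroup_subset hW
  have hQ : ∀ W ∈ nhds (1 : G ⧸ H), ∃ U : Subgroup (G ⧸ H), IsOpen (U : Set (G ⧸ H)) ∧
      IsCompact (U : Set (G ⧸ H)) ∧ (U : Set (G ⧸ H)) ⊆ W := fun W hW ↦ by
    -- Images of compact open subgroups of `G` form a base at `1`, so total disconnectedness of `G ⧸
    -- H` need not be shown.
    obtain ⟨U, hUo, hUc, hUW⟩ := hG ((↑) ⁻¹' W)
      (QuotientGroup.continuous_mk.continuousAt.preimage_mem_nhds hW)
    exact ⟨U.map (QuotientGroup.mk' H), QuotientGroup.isOpenMap_coe _ hUo,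
      hUc.image QuotientGroup.continuous_mk, Set.image_subset_iff.2 hUW⟩
  apply le_antisymm
  · rw [groupTopEntropy_eq_iSup φ hG]
    refine iSup₂_le fun L hL ↦ ?_
    refine (ENNReal.log_le_log (Nat.cast_le.2 (hL.expansionIndex_le_mul H hstable))).trans ?_
    rw [Nat.cast_mul, ENNReal.log_mul_add]
    exact add_le_add (hL.subgroupOf H hstable hclosed).log_le_groupTopEntropy
      (hL.map_mk H hstable).log_le_groupTopEntropy
  · rw [groupTopEntropy_eq_iSup _ hHb, groupTopEntropy_eq_iSup _ hQ]
    refine EReal.add_le_of_forall_lt fun a ha b hb ↦ ?_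
    obtain ⟨L, ha⟩ := lt_iSup_iff.1 ha
    obtain ⟨hL, haL⟩ := lt_iSup_iff.1 ha
    obtain ⟨M, hb⟩ := lt_iSup_iff.1 hb
    obtain ⟨hM, hbM⟩ := lt_iSup_iff.1 hb
    exact (add_le_add haL.le hbM.le).trans
      (log_expansionIndex_add_le_groupTopEntropy H hstable hclosed hL hM)
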